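/- For $\sigma\in(0,1)$ let $G(a)=\tfrac12(a^+-\sigma^2a^-)$, where $a^+=\max\{0,a\}$ and $a^-=\max\{0,-a\}$. For $\lambda\in(0,\tfrac12)$ let $$\varphi_\lambda(x)=\int_0^\infty y^{-2\lambda}e^{-(y-x)^2/2}\,dy,\qquad x\in\mathbb R .$$ Then there is a unique $x_1^\lambda<0$ with $\varphi_\lambda''(x_1^\lambda)=0$ and a unique $z^\lambda>0$ with $\varphi_\lambda''(z^\lambda)+\varphi_\lambda''(-z^\lambda)=0$; put $\sigma_\lambda=-x_1^\lambda/z^\lambda$. For each $\sigma\in(0,1)$ there is a unique $\lambda_\sigma\in(0,\tfrac12)$ with $\sigma_{\lambda_\sigma}=\sigma$. Define $$H_{\lambda,\sigma}(x)=\begin{cases}\mu_1\varphi_\lambda(x)+\mu_2\varphi_\lambda(-x), & x\le-\sigma z^\lambda,\\ \varphi_\lambda(x/\sigma)+\varphi_\lambda(-x/\sigma), & -\sigma z^\lambda<x<\sigma z^\lambda,\\ \mu_2\varphi_\lambda(x)+\mu_1\varphi_\lambda(-x), & x\ge\sigma z^\lambda,\end{cases}$$ where, with $s=\sigma z^\lambda$,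 $$\mu_1=\frac{\varphi_\lambda''(s)\,[\varphi_\lambda(-z^\lambda)+\varphi_\lambda(z^\lambda)]}{\varphi_\lambda(-s)\varphi_\lambda''(s)-\varphi_\lambda(s)\varphi_\lambda''(-s)},\qquad \mu_2=\frac{\varphi_\lambda''(-s)\,[\varphi_\lambda(-z^\lambda)+\varphi_\lambda(z^\lambda)]}{\varphi_\lambda(s)\varphi_\lambda''(-s)-\varphi_\lambda(-s)\varphi_\lambda''(s)} .$$ **Theorem.** Let $\sigma\in(0,1)$. For every $\lambda\in(0,\lambda_\sigma]$ one has $\mu_1>0$ and $\mu_2\ge0$, and the function $$u(t,x)=(1+t)^{-\lambda}H_{\lambda,\sigma}\!\left(\frac{x}{\sqrt{1+t}}\right)$$ is a positive classical solution on $[0,\infty)\times\mathbb R$ of the $G$-heat equation $\partial_tu-G(\partial^2_{xx}u)=0$ with initial datum $u(0,x)=H_{\lambda,\sigma}(x)$; that is, $u,\partial_tu,\partial_xu,\partial_{xx}^2u$ exist and are continuous on $[0,\infty)\times\mathbb R$ (the time derivative at $t=0$ being one-sided), and the equation holds at every point of $[0,\infty)\times\mathbb R$. The existence and uniqueness of $x_1^\lambda$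 and $z^\lambda$ (for all $\lambda\in(0,\tfrac12)$) and of $\lambda_\sigma$ are part of the claim. -/

import Mathlib

open Set MeasureTheory

noncomputable section

namespace GHeat

/-- The function `G(a) = (a⁺ - σ² a⁻) / 2`. -/
def G (σ a : ℝ) : ℝ := (max 0 a - σ ^ 2 * max 0 (-a)) / 2

/-- `u` is a classical (that is, `C^{1,2}`) solution on `[0,∞) × ℝ` of the G-heat equation
`∂ₜu - G(∂ₓₓu) = 0` with initial datum `f`: the functions `u`, `∂ₜu`, `∂ₓu`, `∂ₓₓu` exist and are
continuous on `[0,∞) × ℝ`, and the equation holds at every point of `[0,∞) × ℝ`.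
The time derivative at `t = 0` is the one-sided one; the values of `u` at `t < 0` are irrelevant. -/
def IsClassicalSolution (σ : ℝ) (f : ℝ → ℝ) (u : ℝ → ℝ → ℝ) : Prop :=
  (∀ x, u 0 x = f x) ∧
  ContinuousOn (fun p : ℝ × ℝ => u p.1 p.2) (Ici 0 ×ˢ univ) ∧
  ∃ ut ux uxx : ℝ → ℝ → ℝ,
    ContinuousOn (fun p : ℝ × ℝ => ut p.1 p.2) (Ici 0 ×ˢ univ) ∧
    ContinuousOn (fun p : ℝ × ℝ => ux p.1 p.2) (Ici 0 ×ˢ univ) ∧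
    ContinuousOn (fun p : ℝ × ℝ => uxx p.1 p.2) (Ici 0 ×ˢ univ) ∧
    ∀ t, 0 ≤ t → ∀ x,
      HasDerivWithinAt (fun s => u s x) (ut t x) (Ici 0) t ∧
      HasDerivAt (fun y => u t y) (ux t x) x ∧
      HasDerivAt (fun y => ux t y) (uxx t x) x ∧
      ut t x - G σ (uxx t x) = 0

/-- `φ_l(x) = ∫₀^∞ y^{-2l} exp(-(y-x)²/2) dy`. -/
def phi (l x : ℝ) : ℝ :=
  ∫ y in Ioi (0 : ℝ), y ^ (-2 * l) * Real.exp (-(y - x) ^ 2 / 2)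

/-- The second derivative `φ_l''`. -/
def phi'' (l x : ℝ) : ℝ := iteratedDeriv 2 (phi l) x

/-- The defining property of `x₁^l`: it is negative and a zero of `φ_l''`. -/
def IsX1 (l x : ℝ) : Prop := x < 0 ∧ phi'' l x = 0

/-- The defining property of `z^l`: it is positive and `φ_l''(z) + φ_l''(-z) = 0`. -/
def IsZ (l z : ℝ) : Prop := 0 < z ∧ phi'' l z + phi'' l (-z) = 0

/-- The constant `x₁^l`. -/
def x1 (l : ℝ) : ℝ := Classical.epsilon (IsX1 l)

/-- The constant `z^l`. -/
def z (l : ℝ) : ℝ := Classical.epsilon (IsZ l)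

/-- `σ_l = -x₁^l / z^l`. -/
def sigmaOf (l : ℝ) : ℝ := -x1 l / z l

/-- The defining property of `λ_σ`: it lies in `(0, 1/2)` and `σ_{λ_σ} = σ`. -/
def IsLambda (σ l : ℝ) : Prop := l ∈ Ioo (0 : ℝ) (1 / 2) ∧ sigmaOf l = σ

/-- The constant `λ_σ`. -/
def lambdaOf (σ : ℝ) : ℝ := Classical.epsilon (IsLambda σ)

/-- The coefficient `μ₁`. -/
def mu1 (l σ : ℝ) : ℝ :=
  phi'' l (σ * z l) *
    (phi l (-(σ * z l)) * phi'' l (σ * z l) - phi l (σ * z l) * phi'' l (-(σ * z l)))⁻¹ *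
    (phi l (-z l) + phi l (z l))

/-- The coefficient `μ₂`. -/
def mu2 (l σ : ℝ) : ℝ :=
  phi'' l (-(σ * z l)) *
    (phi l (σ * z l) * phi'' l (-(σ * z l)) - phi l (-(σ * z l)) * phi'' l (σ * z l))⁻¹ *
    (phi l (-z l) + phi l (z l))

/-- The profile `H_{l,σ}`. -/
def H (l σ x : ℝ) : ℝ :=
  if x ≤ -(σ * z l) then mu1 l σ * phi l x + mu2 l σ * phi l (-x)
  else if x < σ * z l then phi l (x / σ) + phi l (-x / σ)
  else mu2 l σ * phi l x + mu1 l σ * phi l (-x)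

/-- `u(t,x) = (1+t)^{-l} H_{l,σ}(x / √(1+t))`. -/
def u (l σ t x : ℝ) : ℝ := (1 + t) ^ (-l) * H l σ (x / Real.sqrt (1 + t))

end GHeat

end

/-!
For `p = 2 l` the function `φ_l` is a positive solution of `h'' + x h' + p h = 0`, and so are its
reflection `φ_l(-x)` and the even function `φ_l(x) + φ_l(-x)` (`isPosSol_phi`,
`isPosSol_evenSol`). The whole argument rests on three facts about such solutions.

*One sign change.* The function `e^{x²/2} x^{-p-1} h''` is strictly increasing on `(0, ∞)`
(`IsPosSol.strictMonoOn_weighted`), so `h''` has at most one zero there, negative before and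
positive after it. If `h'(0) ≤ 0`, a zero exists, since a positive decreasing function is not
concave on a half-line. The reflection yields `-x₁^l` and the even solution yields `z^l`.

*Comparison in the exponent.* For solutions `h`, `k` with exponents `p < p'` the quantity
`e^{x²/2} (p' h' k - p k' h)` is strictly increasing on `[0, ∞)` when `h'(0), k'(0) ≤ 0`, and at a
zero of `h''` its sign is that of `k''`. For the even solutions it vanishes at `0`, so `z^l`
decreases in `l`; for the reflections it vanishes at infinity, so `-x₁^l` increases. Hence `σ_l`
is strictly increasing, and it is continuous because its ingredients are zeros of continuous
families. As `l → 0` the equation becomes `φ'' = -x φ'`, which forces `-x₁^l → 0`; as `l → 1/2`,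
integration by parts gives `(1 - 2 l) φ_l'' → (x² - 1) e^{-x²/2}`, which brings both `-x₁^l` and
`z^l` close to `1`. The intermediate value theorem gives `λ_σ`.

*Gluing.* Put `s = σ z^l`. If `l ≤ λ_σ` then `-x₁^l ≤ s < z^l`, so `φ_l''(-s) ≥ 0 > φ_l''(s)`, and
the signs of `μ₁`, `μ₂` follow. The coefficients are chosen so that the outer and the inner part of
`H` have the same value and vanishing second derivative at `±s`; the two differential equations
then equate the first derivatives. So `H` is `C²`, convex outside `(-s, s)` and concave inside,
and `G` acts there as `a / 2` and `σ² a / 2` respectively (`exists_glued_profile`). The scaling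
`isClassicalSolution_selfSimilar` turns this ordinary differential equation into the G-heat
equation.
-/

noncomputable section

namespace GHeat

open Filter Topology

/-! ### Gaussian moments on the half-line -/

/-- `J q x = ∫₀^∞ y^q exp(-y²/2 + xy) dy`. -/
def J (q x : ℝ) : ℝ := ∫ y in Ioi (0 : ℝ), y ^ q * Real.exp (-y ^ 2 / 2 + x * y)

theorem integrableOn_J {q : ℝ} (hq : -1 < q) (x : ℝ) :
    IntegrableOn (fun y : ℝ => y ^ q * Real.exp (-y ^ 2 / 2 + x * y)) (Ioi 0) := by
  have h := (integrableOn_rpow_mul_exp_neg_mul_sq (b := 1 / 4) (by norm_num) hq).const_mul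
    (Real.exp (x ^ 2))
  refine h.mono' (by fun_prop) ?_
  filter_upwards [ae_restrict_mem measurableSet_Ioi] with y hy
  have hy0 : 0 < y := hy
  rw [Real.norm_of_nonneg (by positivity), mul_left_comm, ← Real.exp_add]
  refine mul_le_mul_of_nonneg_left (Real.exp_le_exp.2 ?_) (by positivity)
  nlinarith [sq_nonneg (y / 2 - x)]

theorem J_pos {q : ℝ} (hq : -1 < q) (x : ℝ) : 0 < J q x := by
  unfold J
  rw [setIntegral_pos_iff_support_of_nonneg_ae _ (integrableOn_J hq x)]
  · have : Ioi (0 : ℝ) ⊆ Function.support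
        (fun y : ℝ => y ^ q * Real.exp (-y ^ 2 / 2 + x * y)) := fun y hy => by
      have hy0 : 0 < y := hy
      exact (by positivity : y ^ q * Real.exp (-y ^ 2 / 2 + x * y) ≠ 0)
    rw [inter_eq_right.2 this]
    simp
  · filter_upwards [ae_restrict_mem measurableSet_Ioi] with y hy
    have hy0 : 0 < y := hy
    simp only [Pi.zero_apply]
    positivity

theorem J_mono {q : ℝ} (hq : -1 < q) {x x' : ℝ} (h : x ≤ x') : J q x ≤ J q x' := by
  refine setIntegral_mono_on (integrableOn_J hq x) (integrableOn_J hq x') measurableSet_Ioi ?_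
  intro y hy
  have hy0 : 0 < y := hy
  gcongr

theorem hasDerivAt_J {q : ℝ} (hq : -1 < q) (x : ℝ) : HasDerivAt (J q) (J (q + 1) x) x := by
  unfold J
  refine (hasDerivAt_integral_of_dominated_loc_of_deriv_le
    (μ := volume.restrict (Ioi (0 : ℝ)))
    (F := fun x y => y ^ q * Real.exp (-y ^ 2 / 2 + x * y))
    (F' := fun x y => y ^ (q + 1) * Real.exp (-y ^ 2 / 2 + x * y))
    (bound := fun y => y ^ (q + 1) * Real.exp (-y ^ 2 / 2 + (x + 1) * y))
    (s := Iio (x + 1)) (Iio_mem_nhds (by linarith)) (.of_forall fun _ => by fun_prop)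
    (integrableOn_J hq x) (by fun_prop) ?_ (integrableOn_J (by linarith) (x + 1)) ?_).2
  · filter_upwards [ae_restrict_mem measurableSet_Ioi] with y hy w hw
    have hy0 : 0 < y := hy
    have hw' : w < x + 1 := hw
    rw [Real.norm_of_nonneg (by positivity)]
    gcongr
  · filter_upwards [ae_restrict_mem measurableSet_Ioi] with y hy w _
    have hy0 : 0 < y := hy
    have h1 : HasDerivAt (fun w : ℝ => -y ^ 2 / 2 + w * y) (1 * y) w :=
      ((hasDerivAt_id w).mul_const y).const_add _
    refine (h1.exp.const_mul (y ^ q)).congr_deriv ?_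
    rw [Real.rpow_add_one hy0.ne']
    ring

/-- Integration by parts. For `a = 0` the term `a * J (a - 1) x` is a vanishing multiple of a
divergent integral, and the boundary term `0 ^ a` equals `1`. -/
theorem J_recurrence {a : ℝ} (ha : 0 ≤ a) (x : ℝ) :
    J (a + 1) x - x * J a x = a * J (a - 1) x + 0 ^ a := by
  have i1 := integrableOn_J (q := a + 1) (by linarith) x
  have i2 := (integrableOn_J (q := a) (by linarith) x).const_mul x
  have i3 : IntegrableOn
      (fun y : ℝ => a * (y ^ (a - 1) * Real.exp (-y ^ 2 / 2 + x * y))) (Ioi 0) := by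
    rcases ha.eq_or_lt with rfl | h
    · simp
    · exact (integrableOn_J (q := a - 1) (by linarith) x).const_mul a
  have hd : ∀ y ∈ Ioi (0 : ℝ), HasDerivAt (fun y : ℝ => y ^ a * Real.exp (-y ^ 2 / 2 + x * y))
      (a * (y ^ (a - 1) * Real.exp (-y ^ 2 / 2 + x * y)) -
        (y ^ (a + 1) * Real.exp (-y ^ 2 / 2 + x * y) -
          x * (y ^ a * Real.exp (-y ^ 2 / 2 + x * y)))) y := by
    intro y hy
    have hy0 : 0 < y := hy
    have h1 : HasDerivAt (fun y : ℝ => -y ^ 2 / 2 + x * y) (-y + x) y := by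
      refine ((((hasDerivAt_id y).pow 2).neg.div_const 2).add
        ((hasDerivAt_id y).const_mul x)).congr_deriv ?_
      simp
      ring
    refine ((Real.hasDerivAt_rpow_const (p := a) (Or.inl hy0.ne')).mul h1.exp).congr_deriv ?_
    rw [Real.rpow_add_one hy0.ne']
    ring
  have hi := i3.sub (i1.sub i2)
  have hcont : ContinuousWithinAt (fun y : ℝ => y ^ a * Real.exp (-y ^ 2 / 2 + x * y))
      (Ici 0) 0 := by
    refine ContinuousAt.continuousWithinAt ?_
    exact (Real.continuousAt_rpow_const 0 a (Or.inr ha)).mul (by fun_prop)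
  have hlim : Tendsto (fun y : ℝ => y ^ a * Real.exp (-y ^ 2 / 2 + x * y)) atTop (𝓝 0) :=
    tendsto_zero_of_hasDerivAt_of_integrableOn_Ioi hd hi (integrableOn_J (by linarith) x)
  have key := integral_Ioi_of_hasDerivAt_of_tendsto hcont hd hi hlim
  have e : ∫ y in Ioi (0 : ℝ), (a * (y ^ (a - 1) * Real.exp (-y ^ 2 / 2 + x * y)) -
        (y ^ (a + 1) * Real.exp (-y ^ 2 / 2 + x * y) -
          x * (y ^ a * Real.exp (-y ^ 2 / 2 + x * y)))) =
      a * J (a - 1) x - (J (a + 1) x - x * J a x) := by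
    unfold J
    rw [← integral_const_mul, ← integral_const_mul, ← integral_sub i1 i2]
    exact integral_sub i3 (i1.sub i2)
  rw [e] at key
  simp only [ne_eq, OfNat.ofNat_ne_zero, not_false_eq_true, zero_pow, neg_zero, zero_div,
    mul_zero, add_zero, Real.exp_zero, mul_one, zero_sub] at key
  linarith

theorem continuousOn_J_left (x : ℝ) : ContinuousOn (fun q => J q x) (Ioi (-1)) := by
  intro q hq
  have hq' : -1 < q := hq
  obtain ⟨a, ha, haq⟩ := exists_between hq'
  refine ContinuousAt.continuousWithinAt ?_
  refine continuousAt_of_dominated (μ := volume.restrict (Ioi (0 : ℝ)))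
    (F := fun q y => y ^ q * Real.exp (-y ^ 2 / 2 + x * y))
    (bound := fun y => y ^ a * Real.exp (-y ^ 2 / 2 + x * y) +
      y ^ (q + 1) * Real.exp (-y ^ 2 / 2 + x * y))
    (.of_forall fun _ => by fun_prop) ?_
    ((integrableOn_J ha x).add (integrableOn_J (by linarith) x)) ?_
  · filter_upwards [Ioo_mem_nhds haq (lt_add_one q)] with w hw
    filter_upwards [ae_restrict_mem measurableSet_Ioi] with y hy
    have hy0 : 0 < y := hy
    rw [Real.norm_of_nonneg (by positivity), ← add_mul]
    gcongr
    rcases le_total y 1 with h | h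
    · have := Real.rpow_le_rpow_of_exponent_ge hy0 h hw.1.le
      have : 0 < y ^ (q + 1) := by positivity
      linarith
    · have := Real.rpow_le_rpow_of_exponent_le h hw.2.le
      have : 0 < y ^ a := by positivity
      linarith
  · filter_upwards [ae_restrict_mem measurableSet_Ioi] with y hy
    have hy0 : 0 < y := hy
    exact (Real.continuousAt_const_rpow hy0.ne').mul continuousAt_const

/-! ### Positive solutions of `h'' + x h' + p h = 0` -/

/-- `h` is a positive solution on `ℝ` of `h'' + x h' + p h = 0` with derivative `h1`; the second
derivative is replaced by the expression that the equation gives for it. -/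
structure IsPosSol (p : ℝ) (h h1 : ℝ → ℝ) : Prop where
  pos : ∀ x, 0 < h x
  deriv1 : ∀ x, HasDerivAt h (h1 x) x
  deriv2 : ∀ x, HasDerivAt h1 (-(x * h1 x + p * h x)) x

theorem hasDerivAt_exp_half_sq (x : ℝ) :
    HasDerivAt (fun x : ℝ => Real.exp (x ^ 2 / 2)) (x * Real.exp (x ^ 2 / 2)) x := by
  have h1 : HasDerivAt (fun x : ℝ => x ^ 2 / 2) x x :=
    (((hasDerivAt_id x).pow 2).div_const 2).congr_deriv (by simp)
  exact h1.exp.congr_deriv (by ring)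

namespace IsPosSol

variable {p : ℝ} {h h1 : ℝ → ℝ}

theorem continuous_fun (s : IsPosSol p h h1) : Continuous h :=
  continuous_iff_continuousAt.2 fun x => (s.deriv1 x).continuousAt

theorem continuous_deriv (s : IsPosSol p h h1) : Continuous h1 :=
  continuous_iff_continuousAt.2 fun x => (s.deriv2 x).continuousAt

theorem reflect (s : IsPosSol p h h1) : IsPosSol p (fun x => h (-x)) (fun x => -h1 (-x)) where
  pos x := s.pos _
  deriv1 x := by
    refine ((s.deriv1 (-x)).comp x (hasDerivAt_neg x)).congr_deriv ?_
    ring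
  deriv2 x := by
    refine ((s.deriv2 (-x)).comp x (hasDerivAt_neg x)).neg.congr_deriv ?_
    ring

/-- A nontrivial combination with nonnegative coefficients is again a positive solution. -/
theorem combo {k k1 : ℝ → ℝ} (s : IsPosSol p h h1) (t : IsPosSol p k k1) {a b : ℝ}
    (ha : 0 ≤ a) (hb : 0 < b) :
    IsPosSol p (fun x => a * h x + b * k x) (fun x => a * h1 x + b * k1 x) where
  pos x := add_pos_of_nonneg_of_pos (mul_nonneg ha (s.pos x).le) (mul_pos hb (t.pos x))
  deriv1 x := ((s.deriv1 x).const_mul a).add ((t.deriv1 x).const_mul b)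
  deriv2 x := by
    refine (((s.deriv2 x).const_mul a).add ((t.deriv2 x).const_mul b)).congr_deriv ?_
    ring

theorem deriv_neg (s : IsPosSol p h h1) (hp : 0 < p) (h0 : h1 0 ≤ 0) {x : ℝ} (hx : 0 < x) :
    h1 x < 0 := by
  -- `(e^{x²/2} h')' = -p e^{x²/2} h < 0`
  have hd : ∀ y : ℝ, HasDerivAt (fun y => Real.exp (y ^ 2 / 2) * h1 y)
      (-(p * (Real.exp (y ^ 2 / 2) * h y))) y := fun y =>
    ((hasDerivAt_exp_half_sq y).mul (s.deriv2 y)).congr_deriv (by ring)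
  have hanti : StrictAnti (fun y => Real.exp (y ^ 2 / 2) * h1 y) := by
    refine strictAnti_of_deriv_neg fun y => ?_
    rw [(hd y).deriv]
    have := s.pos y
    have : 0 < p * (Real.exp (y ^ 2 / 2) * h y) := by positivity
    linarith
  have := hanti hx
  simp only [ne_eq, OfNat.ofNat_ne_zero, not_false_eq_true, zero_pow, zero_div, Real.exp_zero,
    one_mul] at this
  exact (pos_iff_neg_of_mul_neg (this.trans_le h0)).1 (Real.exp_pos _)

/-- A positive solution changes the sign of its second derivative at most once on `(0, ∞)`, from
negative to positive: `e^{x²/2} x^{-p-1} h''` has derivative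
`p (p + 1) e^{x²/2} x^{-p-2} h`. -/
theorem strictMonoOn_weighted (s : IsPosSol p h h1) (hp : 0 < p) :
    StrictMonoOn (fun x => Real.exp (x ^ 2 / 2) * x ^ (-p - 1) * -(x * h1 x + p * h x))
      (Ioi 0) := by
  have hd : ∀ x : ℝ, 0 < x → HasDerivAt
      (fun x => Real.exp (x ^ 2 / 2) * x ^ (-p - 1) * -(x * h1 x + p * h x))
      (p * (p + 1) * (Real.exp (x ^ 2 / 2) * x ^ (-p - 2) * h x)) x := by
    intro x hx
    refine (((hasDerivAt_exp_half_sq x).mul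
      (Real.hasDerivAt_rpow_const (p := -p - 1) (Or.inl hx.ne'))).mul
      (((hasDerivAt_id x).mul (s.deriv2 x)).add ((s.deriv1 x).const_mul p)).neg).congr_deriv ?_
    have e1 : x ^ (-p - 1) = x ^ (-p - 2) * x := by
      rw [← Real.rpow_add_one hx.ne']
      ring_nf
    have e2 : x ^ (-p - 1 - 1) = x ^ (-p - 2) := by ring_nf
    simp only [Pi.mul_apply, Pi.neg_apply, Pi.add_apply, id, e2, e1]
    ring
  refine strictMonoOn_of_deriv_pos (convex_Ioi 0)
    (fun x hx => (hd x hx).continuousAt.continuousWithinAt) fun x hx => ?_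
  rw [interior_Ioi] at hx
  have hx0 : 0 < x := hx
  have := s.pos x
  rw [(hd x hx).deriv]
  positivity

theorem second_pos_of_lt (s : IsPosSol p h h1) (hp : 0 < p) {a x : ℝ} (ha : 0 < a) (hax : a < x)
    (h2 : 0 ≤ -(a * h1 a + p * h a)) : 0 < -(x * h1 x + p * h x) := by
  have hx : 0 < x := ha.trans hax
  have := s.strictMonoOn_weighted hp (mem_Ioi.2 ha) (mem_Ioi.2 hx) hax
  have h3 : 0 ≤ Real.exp (a ^ 2 / 2) * a ^ (-p - 1) * -(a * h1 a + p * h a) := by positivity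
  exact pos_of_mul_pos_right (h3.trans_lt this) (by positivity)

theorem second_neg_of_lt (s : IsPosSol p h h1) (hp : 0 < p) {a x : ℝ} (hx : 0 < x) (hxa : x < a)
    (h2 : -(a * h1 a + p * h a) ≤ 0) : -(x * h1 x + p * h x) < 0 := by
  by_contra! hc
  exact (s.second_pos_of_lt hp hx hxa hc).not_ge h2

/-- A solution with `h'(0) ≤ 0` cannot be concave on all of `(0, ∞)`, since a positive
decreasing function is not. -/
theorem exists_second_eq_zero (s : IsPosSol p h h1) (hp : 0 < p) (h0 : h1 0 ≤ 0) :
    ∃ r, 0 < r ∧ -(r * h1 r + p * h r) = 0 := by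
  have hcont : Continuous fun x => -(x * h1 x + p * h x) := by
    have := s.continuous_fun
    have := s.continuous_deriv
    fun_prop
  by_cases hex : ∃ b, 0 < b ∧ 0 ≤ -(b * h1 b + p * h b)
  · obtain ⟨b, hb, hb'⟩ := hex
    have h00 : -(0 * h1 0 + p * h 0) < 0 := by
      have := mul_pos hp (s.pos 0)
      linarith
    obtain ⟨r, hr, hr'⟩ := intermediate_value_Icc hb.le hcont.continuousOn ⟨h00.le, hb'⟩
    refine ⟨r, hr.1.lt_of_ne ?_, hr'⟩
    rintro rfl
    exact h00.ne hr'
  · push Not at hex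
    have hanti : AntitoneOn h1 (Ici 0) := by
      refine antitoneOn_of_deriv_nonpos (convex_Ici 0) s.continuous_deriv.continuousOn
        (fun x _ => (s.deriv2 x).differentiableAt.differentiableWithinAt) fun x hx => ?_
      rw [interior_Ici] at hx
      rw [(s.deriv2 x).deriv]
      exact (hex x hx).le
    have hneg := s.deriv_neg hp h0 one_pos
    have hbd : ∀ x, 1 < x → h x ≤ h 1 + h1 1 * (x - 1) := by
      intro x hx
      obtain ⟨c, hc, hc'⟩ := exists_hasDerivAt_eq_slope h h1 hx s.continuous_fun.continuousOn
        fun x _ => s.deriv1 x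
      have h3 : h1 c ≤ h1 1 := hanti (mem_Ici.2 zero_le_one)
        (mem_Ici.2 (zero_le_one.trans hc.1.le)) hc.1.le
      rw [hc', div_le_iff₀ (by linarith)] at h3
      linarith
    have hh := s.pos 1
    have h4 := hbd (1 + h 1 / -h1 1) (by linarith [div_pos hh (neg_pos.2 hneg)])
    have h5 : h1 1 * (1 + h 1 / -h1 1 - 1) = -h 1 := by
      have := hneg.ne
      field_simp
      ring
    linarith [s.pos (1 + h 1 / -h1 1)]

end IsPosSol

/-- The Wronskian-type quantity `e^{x²/2} (p' h' k - p k' h)` that compares the logarithmic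
derivatives of solutions `h`, `k` for two exponents `p`, `p'`. -/
def wronsk (p p' : ℝ) (h h1 k k1 : ℝ → ℝ) (x : ℝ) : ℝ :=
  Real.exp (x ^ 2 / 2) * (p' * h1 x * k x - p * k1 x * h x)

section Comparison

variable {p p' : ℝ} {h h1 k k1 : ℝ → ℝ}

theorem strictMonoOn_wronsk (s : IsPosSol p h h1) (t : IsPosSol p' k k1) (hp : 0 < p)
    (hpp : p < p') (hh : h1 0 ≤ 0) (hk : k1 0 ≤ 0) :
    StrictMonoOn (wronsk p p' h h1 k k1) (Ici 0) := by
  have hd : ∀ x, HasDerivAt (wronsk p p' h h1 k k1)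
      ((p' - p) * (Real.exp (x ^ 2 / 2) * (h1 x * k1 x))) x := by
    intro x
    refine ((hasDerivAt_exp_half_sq x).mul
      ((((s.deriv2 x).const_mul p').mul (t.deriv1 x)).sub
        (((t.deriv2 x).const_mul p).mul (s.deriv1 x)))).congr_deriv ?_
    simp only [Pi.mul_apply, Pi.sub_apply]
    ring
  refine strictMonoOn_of_deriv_pos (convex_Ici 0)
    (fun x _ => (hd x).continuousAt.continuousWithinAt) fun x hx => ?_
  rw [interior_Ici] at hx
  rw [(hd x).deriv]
  exact mul_pos (sub_pos.2 hpp) (mul_pos (Real.exp_pos _)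
    (mul_pos_of_neg_of_neg (s.deriv_neg hp hh hx) (t.deriv_neg (hp.trans hpp) hk hx)))

/-- At a zero of `h''` the sign of `k''` is the sign of the Wronskian. -/
theorem mul_wronsk_of_second_eq_zero {x : ℝ} (hx : -(x * h1 x + p * h x) = 0) :
    x * wronsk p p' h h1 k k1 x =
      Real.exp (x ^ 2 / 2) * (p * h x) * -(x * k1 x + p' * k x) := by
  unfold wronsk
  linear_combination (-(Real.exp (x ^ 2 / 2) * p' * k x)) * hx

end Comparison

/-! ### The constants `x₁^l`, `z^l`, `σ_l` and `λ_σ` -/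

/-- The derivative of `φ_l` for `p = 2 l`. -/
def phi1 (l x : ℝ) : ℝ :=
  Real.exp (-x ^ 2 / 2) * (J (1 - 2 * l) x - x * J (-2 * l) x)

theorem phi_eq (l x : ℝ) : phi l x = Real.exp (-x ^ 2 / 2) * J (-2 * l) x := by
  unfold phi J
  rw [← integral_const_mul]
  congr 1
  ext y
  rw [mul_left_comm, ← Real.exp_add]
  ring_nf

theorem hasDerivAt_exp_neg_half_sq (x : ℝ) :
    HasDerivAt (fun x : ℝ => Real.exp (-x ^ 2 / 2)) (-x * Real.exp (-x ^ 2 / 2)) x := by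
  have h1 : HasDerivAt (fun x : ℝ => -x ^ 2 / 2) (-x) x :=
    (((hasDerivAt_id x).pow 2).neg.div_const 2).congr_deriv (by simp; ring)
  exact h1.exp.congr_deriv (by ring)

theorem isPosSol_phi {l : ℝ} (hl : l < 1 / 2) : IsPosSol (2 * l) (phi l) (phi1 l) where
  pos x := by
    rw [phi_eq]
    exact mul_pos (Real.exp_pos _) (J_pos (by linarith) x)
  deriv1 x := by
    rw [funext (phi_eq l)]
    refine ((hasDerivAt_exp_neg_half_sq x).mul
      (hasDerivAt_J (q := -2 * l) (by linarith) x)).congr_deriv ?_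
    rw [phi1, show -2 * l + 1 = 1 - 2 * l by ring]
    ring
  deriv2 x := by
    have h := J_recurrence (a := 1 - 2 * l) (by linarith) x
    rw [Real.zero_rpow (by linarith), show 1 - 2 * l - 1 = -2 * l by ring] at h
    refine ((hasDerivAt_exp_neg_half_sq x).mul
      ((hasDerivAt_J (q := 1 - 2 * l) (by linarith) x).sub
        ((hasDerivAt_id x).mul (hasDerivAt_J (q := -2 * l) (by linarith) x)))).congr_deriv ?_
    simp only [Pi.mul_apply, Pi.sub_apply, id, phi_eq, phi1,
      show -2 * l + 1 = 1 - 2 * l by ring]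
    linear_combination Real.exp (-x ^ 2 / 2) * h

theorem phi''_eq {l : ℝ} (hl : l < 1 / 2) (x : ℝ) :
    phi'' l x = -(x * phi1 l x + 2 * l * phi l x) := by
  have s := isPosSol_phi hl
  rw [phi'', iteratedDeriv_succ, iteratedDeriv_one, funext fun y => (s.deriv1 y).deriv,
    (s.deriv2 x).deriv]

theorem phi1_pos_of_nonpos {l x : ℝ} (hl : l < 1 / 2) (hx : x ≤ 0) : 0 < phi1 l x := by
  have h1 := J_pos (q := 1 - 2 * l) (by linarith) x
  have h2 := J_pos (q := -2 * l) (by linarith) x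
  have : 0 ≤ -x * J (-2 * l) x := mul_nonneg (by linarith) h2.le
  exact mul_pos (Real.exp_pos _) (by linarith)

/-- The even solution `φ_l(x) + φ_l(-x)`. -/
def evenSol (l x : ℝ) : ℝ := phi l x + phi l (-x)

/-- The derivative of `evenSol`. -/
def evenSol1 (l x : ℝ) : ℝ := phi1 l x - phi1 l (-x)

theorem isPosSol_evenSol {l : ℝ} (hl : l < 1 / 2) :
    IsPosSol (2 * l) (evenSol l) (evenSol1 l) := by
  have s := isPosSol_phi hl
  convert s.combo s.reflect zero_le_one one_pos using 1
  · ext x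
    simp [evenSol]
  · ext x
    simp [evenSol1, sub_eq_add_neg]

theorem evenSol1_zero (l : ℝ) : evenSol1 l 0 = 0 := by simp [evenSol1]

theorem second_reflect {l : ℝ} (hl : l < 1 / 2) (x : ℝ) :
    -(x * -phi1 l (-x) + 2 * l * phi l (-x)) = phi'' l (-x) := by
  rw [phi''_eq hl]
  ring

theorem second_evenSol {l : ℝ} (hl : l < 1 / 2) (x : ℝ) :
    -(x * evenSol1 l x + 2 * l * evenSol l x) = phi'' l x + phi'' l (-x) := by
  rw [phi''_eq hl, phi''_eq hl, evenSol, evenSol1]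
  ring

theorem reflect_deriv_zero {l : ℝ} (hl : l < 1 / 2) : -phi1 l (-0) ≤ 0 := by
  rw [neg_zero]
  exact (neg_neg_of_pos (phi1_pos_of_nonpos hl le_rfl)).le

/-- `-x₁^l`, as the positive zero of the second derivative of `φ_l(-x)`. -/
theorem exists_rootX {l : ℝ} (hl : l ∈ Ioo (0 : ℝ) (1 / 2)) :
    ∃ r, 0 < r ∧ (∀ x, 0 < x → x < r → phi'' l (-x) < 0) ∧ phi'' l (-r) = 0 ∧
      ∀ x, r < x → 0 < phi'' l (-x) := by
  have s := (isPosSol_phi hl.2).reflect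
  have hp : 0 < 2 * l := by linarith [hl.1]
  obtain ⟨r, hr, hr0⟩ := s.exists_second_eq_zero hp (reflect_deriv_zero hl.2)
  refine ⟨r, hr, fun x hx hxr => ?_, ?_, fun x hx => ?_⟩
  · rw [← second_reflect hl.2]
    exact s.second_neg_of_lt hp hx hxr hr0.le
  · rwa [← second_reflect hl.2]
  · rw [← second_reflect hl.2]
    exact s.second_pos_of_lt hp hr hx hr0.ge

theorem exists_rootZ {l : ℝ} (hl : l ∈ Ioo (0 : ℝ) (1 / 2)) :
    ∃ r, 0 < r ∧ (∀ x, 0 < x → x < r → phi'' l x + phi'' l (-x) < 0) ∧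
      phi'' l r + phi'' l (-r) = 0 ∧ ∀ x, r < x → 0 < phi'' l x + phi'' l (-x) := by
  have s := isPosSol_evenSol hl.2
  have hp : 0 < 2 * l := by linarith [hl.1]
  obtain ⟨r, hr, hr0⟩ := s.exists_second_eq_zero hp (evenSol1_zero l).le
  refine ⟨r, hr, fun x hx hxr => ?_, ?_, fun x hx => ?_⟩
  · rw [← second_evenSol hl.2]
    exact s.second_neg_of_lt hp hx hxr hr0.le
  · rwa [← second_evenSol hl.2]
  · rw [← second_evenSol hl.2]
    exact s.second_pos_of_lt hp hr hx hr0.ge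

theorem existsUnique_isX1 {l : ℝ} (hl : l ∈ Ioo (0 : ℝ) (1 / 2)) : ∃! x, IsX1 l x := by
  obtain ⟨r, hr, hneg, h0, hpos⟩ := exists_rootX hl
  refine ⟨-r, ⟨by linarith, h0⟩, fun y hy => ?_⟩
  rcases lt_trichotomy (-y) r with h | h | h
  · have := hneg (-y) (by linarith [hy.1]) h
    rw [neg_neg, hy.2] at this
    exact absurd this (lt_irrefl 0)
  · linarith
  · have := hpos (-y) h
    rw [neg_neg, hy.2] at this
    exact absurd this (lt_irrefl 0)

theorem existsUnique_isZ {l : ℝ} (hl : l ∈ Ioo (0 : ℝ) (1 / 2)) : ∃! x, IsZ l x := by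
  obtain ⟨r, hr, hneg, h0, hpos⟩ := exists_rootZ hl
  refine ⟨r, ⟨hr, h0⟩, fun y hy => ?_⟩
  rcases lt_trichotomy y r with h | h | h
  · exact absurd hy.2 (hneg y hy.1 h).ne
  · exact h
  · exact absurd hy.2 (hpos y h).ne'

/-- On `(0, ∞)` the function `f` changes sign exactly at `r`, from negative to positive. -/
def SignChange (f : ℝ → ℝ) (r : ℝ) : Prop :=
  0 < r ∧ ∀ x, 0 < x → (f x < 0 ↔ x < r) ∧ (0 < f x ↔ r < x)

theorem SignChange.of_root {f : ℝ → ℝ} {r : ℝ} (hr : 0 < r)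
    (hneg : ∀ x, 0 < x → x < r → f x < 0) (h0 : f r = 0) (hpos : ∀ x, r < x → 0 < f x) :
    SignChange f r := by
  refine ⟨hr, fun x hx => ?_⟩
  rcases lt_trichotomy x r with h | rfl | h
  · have := hneg x hx h
    exact ⟨⟨fun _ => h, fun _ => this⟩,
      ⟨fun h' => absurd this h'.not_gt, fun h' => absurd h h'.not_gt⟩⟩
  · simp [h0]
  · have := hpos x h
    exact ⟨⟨fun h' => absurd this h'.not_gt, fun h' => absurd h h'.not_gt⟩,
      ⟨fun _ => h, fun _ => this⟩⟩

theorem signChange_x1 {l : ℝ} (hl : l ∈ Ioo (0 : ℝ) (1 / 2)) :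
    SignChange (fun x => phi'' l (-x)) (-x1 l) := by
  obtain ⟨r, hr, hneg, h0, hpos⟩ := exists_rootX hl
  have hx : IsX1 l (x1 l) := Classical.epsilon_spec (existsUnique_isX1 hl).exists
  have : x1 l = -r := (existsUnique_isX1 hl).unique hx ⟨by linarith, h0⟩
  rw [this, neg_neg]
  exact .of_root hr hneg h0 hpos

theorem signChange_z {l : ℝ} (hl : l ∈ Ioo (0 : ℝ) (1 / 2)) :
    SignChange (fun x => phi'' l x + phi'' l (-x)) (z l) := by
  obtain ⟨r, hr, hneg, h0, hpos⟩ := exists_rootZ hl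
  have hz : IsZ l (z l) := Classical.epsilon_spec (existsUnique_isZ hl).exists
  have : z l = r := (existsUnique_isZ hl).unique hz ⟨hr, h0⟩
  rw [this]
  exact .of_root hr hneg h0 hpos

theorem SignChange.eq_zero {f : ℝ → ℝ} {r : ℝ} (h : SignChange f r) : f r = 0 := by
  have := h.2 r h.1
  simp only [lt_irrefl, iff_false, not_lt] at this
  exact le_antisymm this.2 this.1

/-- The zero of a family of sign-changing functions depends continuously on the parameter. -/
theorem continuousOn_of_signChange {f : ℝ → ℝ → ℝ} {r : ℝ → ℝ} {s : Set ℝ}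
    (hr : ∀ l ∈ s, SignChange (f l) (r l))
    (hf : ∀ x, 0 < x → ContinuousOn (fun l => f l x) s) : ContinuousOn r s := by
  intro l hl
  refine tendsto_order.2 ⟨fun a ha => ?_, fun a ha => ?_⟩
  · rcases le_or_gt a 0 with h | h
    · filter_upwards [self_mem_nhdsWithin] with m hm
      exact h.trans_lt (hr m hm).1
    · filter_upwards [self_mem_nhdsWithin,
        (hf a h l hl).eventually_lt_const (((hr l hl).2 a h).1.2 ha)] with m hm hm'
      exact ((hr m hm).2 a h).1.1 hm'
  · have h : 0 < a := (hr l hl).1.trans ha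
    filter_upwards [self_mem_nhdsWithin,
      (hf a h l hl).eventually_const_lt (((hr l hl).2 a h).2.2 ha)] with m hm hm'
    exact ((hr m hm).2 a h).2.1 hm'

/-- The expression obtained from `(1 - 2l) φ_l''(x)` by integration by parts, which stays
continuous up to `l = 1/2`. -/
def scaledSecond (l x : ℝ) : ℝ :=
  -(Real.exp (-x ^ 2 / 2) *
    (x * ((1 - 2 * l) * J (1 - 2 * l) x - x * (J (2 - 2 * l) x - x * J (1 - 2 * l) x)) +
      2 * l * (J (2 - 2 * l) x - x * J (1 - 2 * l) x)))

theorem scaledSecond_eq {l : ℝ} (hl : l < 1 / 2) (x : ℝ) :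
    scaledSecond l x = (1 - 2 * l) * phi'' l x := by
  have h := J_recurrence (a := 1 - 2 * l) (by linarith) x
  rw [Real.zero_rpow (by linarith), show 1 - 2 * l - 1 = -2 * l by ring,
    show 1 - 2 * l + 1 = 2 - 2 * l by ring, add_zero] at h
  rw [scaledSecond, phi''_eq hl, phi_eq, phi1, h]
  ring

theorem scaledSecond_half (x : ℝ) :
    scaledSecond (1 / 2) x = Real.exp (-x ^ 2 / 2) * (x ^ 2 - 1) := by
  have h := J_recurrence (a := 0) le_rfl x
  simp only [zero_add, zero_mul, Real.rpow_zero] at h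
  rw [scaledSecond]
  norm_num
  linear_combination (Real.exp (-x ^ 2 / 2) * (x ^ 2 - 1)) * h

theorem continuousOn_scaledSecond (x : ℝ) :
    ContinuousOn (fun l => scaledSecond l x) (Iio 1) := by
  have h1 : ContinuousOn (fun l : ℝ => J (1 - 2 * l) x) (Iio 1) :=
    (continuousOn_J_left x).comp (by fun_prop) fun l hl => by
      have : l < 1 := hl
      exact mem_Ioi.2 (by linarith)
  have h2 : ContinuousOn (fun l : ℝ => J (2 - 2 * l) x) (Iio 1) :=
    (continuousOn_J_left x).comp (by fun_prop) fun l hl => by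
      have : l < 1 := hl
      exact mem_Ioi.2 (by linarith)
  unfold scaledSecond
  fun_prop

theorem continuousOn_phi'' (x : ℝ) : ContinuousOn (fun l => phi'' l x) (Iio (1 / 2)) := by
  have h : ContinuousOn (fun l => scaledSecond l x / (1 - 2 * l)) (Iio (1 / 2)) := by
    refine ((continuousOn_scaledSecond x).mono (Iio_subset_Iio (by norm_num))).div
      (by fun_prop) fun l hl => ?_
    have : l < 1 / 2 := hl
    linarith
  refine h.congr fun l hl => ?_
  have : l < 1 / 2 := hl
  have : 1 - 2 * l ≠ 0 := by linarith
  simp only [scaledSecond_eq hl]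
  field_simp

theorem continuousOn_x1 : ContinuousOn (fun l => -x1 l) (Ioo 0 (1 / 2)) :=
  continuousOn_of_signChange (f := fun l x => phi'' l (-x)) (fun _ hl => signChange_x1 hl)
    fun x _ => (continuousOn_phi'' (-x)).mono fun _ hl => hl.2

theorem continuousOn_z : ContinuousOn z (Ioo 0 (1 / 2)) :=
  continuousOn_of_signChange (f := fun l x => phi'' l x + phi'' l (-x))
    (fun _ hl => signChange_z hl)
    fun x _ => ((continuousOn_phi'' x).mono fun _ hl => hl.2).add
      ((continuousOn_phi'' (-x)).mono fun _ hl => hl.2)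

theorem z_strictAntiOn : StrictAntiOn z (Ioo 0 (1 / 2)) := by
  intro l hl m hm hlm
  have s := isPosSol_evenSol hl.2
  have t := isPosSol_evenSol hm.2
  have hz := signChange_z hl
  have h0 : wronsk (2 * l) (2 * m) (evenSol l) (evenSol1 l) (evenSol m) (evenSol1 m) 0 = 0 := by
    simp [wronsk, evenSol1_zero]
  have hW := strictMonoOn_wronsk s t (by linarith [hl.1]) (by linarith)
    (evenSol1_zero l).le (evenSol1_zero m).le (mem_Ici.2 le_rfl) (mem_Ici.2 hz.1.le) hz.1
  rw [h0] at hW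
  have e := mul_wronsk_of_second_eq_zero (p' := 2 * m) (k := evenSol m) (k1 := evenSol1 m)
    ((second_evenSol hl.2 (z l)).trans hz.eq_zero)
  rw [second_evenSol hm.2] at e
  have h1 : 0 < Real.exp (z l ^ 2 / 2) * (2 * l * evenSol l (z l)) :=
    mul_pos (Real.exp_pos _) (mul_pos (by linarith [hl.1]) (s.pos _))
  have h2 := e ▸ mul_pos hz.1 hW
  exact ((signChange_z hm).2 _ hz.1).2.1 (pos_of_mul_pos_right h2 h1.le)

/-- Since `φ_l(-x)` and its derivative decay like `e^{-x²/2}`, the Wronskian of two of these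
functions vanishes at infinity. -/
theorem tendsto_wronsk_reflect {l m : ℝ} (hl : l < 1 / 2) (hm : m < 1 / 2) :
    Tendsto (wronsk (2 * l) (2 * m) (fun x => phi l (-x)) (fun x => -phi1 l (-x))
      (fun x => phi m (-x)) (fun x => -phi1 m (-x))) atTop (𝓝 0) := by
  have hx : ∀ n : ℕ, (fun x : ℝ => x ^ n * Real.exp (-x ^ 2 / 2)) =o[atTop]
      (fun _ => (1 : ℝ)) := by
    intro n
    refine (Asymptotics.isLittleO_one_iff ℝ).2 (squeeze_zero' ?_ ?_
      (Real.tendsto_pow_mul_exp_neg_atTop_nhds_zero n))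
    · filter_upwards [eventually_ge_atTop 0] with x hx
      positivity
    · filter_upwards [eventually_ge_atTop 2] with x hx
      have : 0 ≤ x := by linarith
      gcongr
      nlinarith
  have hJ : ∀ q : ℝ, -1 < q → (fun x => J q (-x)) =O[atTop] (fun _ => (1 : ℝ)) := by
    intro q hq
    refine Asymptotics.IsBigO.of_bound (J q 0) ?_
    filter_upwards [eventually_ge_atTop 0] with x hx
    rw [Real.norm_of_nonneg (J_pos hq _).le, norm_one, mul_one]
    exact J_mono hq (by linarith)
  have hl0 := hJ (-2 * l) (by linarith)
  have hl1 := hJ (1 - 2 * l) (by linarith)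
  have hm0 := hJ (-2 * m) (by linarith)
  have hm1 := hJ (1 - 2 * m) (by linarith)
  have e : wronsk (2 * l) (2 * m) (fun x => phi l (-x)) (fun x => -phi1 l (-x))
      (fun x => phi m (-x)) (fun x => -phi1 m (-x)) = fun x =>
      (x ^ 1 * Real.exp (-x ^ 2 / 2)) *
        ((2 * l - 2 * m) * (J (-2 * l) (-x) * J (-2 * m) (-x))) +
      (x ^ 0 * Real.exp (-x ^ 2 / 2)) *
        (2 * l * (J (1 - 2 * m) (-x) * J (-2 * l) (-x)) -
          2 * m * (J (1 - 2 * l) (-x) * J (-2 * m) (-x))) := by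
    ext x
    have h1 : Real.exp (x ^ 2 / 2) * Real.exp (-x ^ 2 / 2) = 1 := by
      rw [← Real.exp_add, neg_div, add_neg_cancel, Real.exp_zero]
    simp only [wronsk, phi_eq, phi1, neg_sq]
    linear_combination (Real.exp (-x ^ 2 / 2) *
      (x * ((2 * l - 2 * m) * (J (-2 * l) (-x) * J (-2 * m) (-x))) +
        (2 * l * (J (1 - 2 * m) (-x) * J (-2 * l) (-x)) -
          2 * m * (J (1 - 2 * l) (-x) * J (-2 * m) (-x))))) * h1
  rw [e, ← Asymptotics.isLittleO_one_iff ℝ]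
  have b1 := (hl0.mul hm0).const_mul_left (2 * l - 2 * m)
  have b2 := ((hm1.mul hl0).const_mul_left (2 * l)).sub ((hl1.mul hm0).const_mul_left (2 * m))
  simp only [mul_one] at b1 b2
  simpa only [mul_one] using ((hx 1).mul_isBigO b1).add ((hx 0).mul_isBigO b2)

theorem x1_strictMonoOn : StrictMonoOn (fun l => -x1 l) (Ioo 0 (1 / 2)) := by
  intro l hl m hm hlm
  have s := (isPosSol_phi hl.2).reflect
  have t := (isPosSol_phi hm.2).reflect
  have hz := signChange_x1 hl
  have hmono := strictMonoOn_wronsk s t (by linarith [hl.1]) (by linarith)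
    (reflect_deriv_zero hl.2) (reflect_deriv_zero hm.2)
  have hr := mem_Ici.2 hz.1.le
  have hr1 : -x1 l + 1 ∈ Ici (0 : ℝ) := mem_Ici.2 (by linarith [hz.1])
  have hW := hmono hr hr1 (lt_add_one _)
  have hW1 := ge_of_tendsto (tendsto_wronsk_reflect hl.2 hm.2)
    (eventually_atTop.2 ⟨-x1 l + 1, fun x hx => hmono.monotoneOn hr1
      (mem_Ici.2 ((mem_Ici.1 hr1).trans hx)) hx⟩)
  replace hW := hW.trans_le hW1
  have e := mul_wronsk_of_second_eq_zero (p' := 2 * m) (h := fun x => phi l (-x))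
    (h1 := fun x => -phi1 l (-x)) (k := fun x => phi m (-x)) (k1 := fun x => -phi1 m (-x))
    ((second_reflect hl.2 (-x1 l)).trans hz.eq_zero)
  rw [second_reflect hm.2] at e
  have h1 : 0 < Real.exp ((-x1 l) ^ 2 / 2) * (2 * l * phi l (- -x1 l)) :=
    mul_pos (Real.exp_pos _) (mul_pos (by linarith [hl.1]) (s.pos _))
  have h2 := e ▸ mul_neg_of_pos_of_neg hz.1 hW
  refine ((signChange_x1 hm).2 _ hz.1).1.1 ?_
  by_contra! hc
  exact h2.not_ge (mul_nonneg h1.le hc)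

theorem sigmaOf_strictMonoOn : StrictMonoOn sigmaOf (Ioo 0 (1 / 2)) := fun _ hl _ hm hlm =>
  div_lt_div₀ (x1_strictMonoOn hl hm hlm) (z_strictAntiOn hl hm hlm).le
    (signChange_x1 hm).1.le (signChange_z hm).1

theorem continuousOn_sigmaOf : ContinuousOn sigmaOf (Ioo 0 (1 / 2)) :=
  continuousOn_x1.div continuousOn_z fun _ hl => (signChange_z hl).1.ne'

theorem exists_sigmaOf_lt {σ : ℝ} (hσ : 0 < σ) : ∃ l ∈ Ioo (0 : ℝ) (1 / 2), sigmaOf l < σ := by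
  -- `z` is decreasing, so `z (1 / 4)` bounds `z l` from below for all small `l`
  have hq : (1 / 4 : ℝ) ∈ Ioo (0 : ℝ) (1 / 2) := by norm_num
  have hc := (signChange_z hq).1
  have hσc : 0 < σ * z (1 / 4) := mul_pos hσ hc
  -- at `l = 0` the equation reads `φ'' = -x φ'`
  have h0 : 0 < phi'' 0 (-(σ * z (1 / 4))) := by
    rw [phi''_eq (by norm_num)]
    have := mul_pos hσc (phi1_pos_of_nonpos (l := 0) (x := -(σ * z (1 / 4))) (by norm_num)
      (by linarith))
    linarith
  have hca : ContinuousAt (fun l => phi'' l (-(σ * z (1 / 4)))) 0 :=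
    (continuousOn_phi'' _).continuousAt (Iio_mem_nhds (by norm_num))
  have hev := (hca.eventually_const_lt h0).filter_mono (nhdsWithin_le_nhds (s := Ioi 0))
  obtain ⟨l, hl, hl'⟩ := (hev.and (Ioo_mem_nhdsGT (show (0 : ℝ) < 1 / 4 by norm_num))).exists
  have hlI : l ∈ Ioo (0 : ℝ) (1 / 2) := ⟨hl'.1, hl'.2.trans (by norm_num)⟩
  refine ⟨l, hlI, (div_lt_iff₀ (signChange_z hlI).1).2 ?_⟩
  have h1 := ((signChange_x1 hlI).2 _ hσc).2.1 hl
  have h2 := z_strictAntiOn hlI hq hl'.2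
  exact h1.trans ((mul_lt_mul_iff_right₀ hσ).2 h2)

theorem exists_lt_sigmaOf {σ : ℝ} (hσ : σ ∈ Ioo (0 : ℝ) 1) :
    ∃ l ∈ Ioo (0 : ℝ) (1 / 2), σ < sigmaOf l := by
  -- near `l = 1/2` both `-x₁` and `z` are close to `1`, hence `-x₁ > √σ` and `z < 1/√σ`
  set a := √σ with ha
  have ha0 : 0 < a := Real.sqrt_pos.2 hσ.1
  have ha2 : a * a = σ := Real.mul_self_sqrt hσ.1.le
  have ha1 : a < 1 := by nlinarith [hσ.2]
  have hb0 : 0 < a⁻¹ := inv_pos.2 ha0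
  have hb1 : 1 < a⁻¹ := (one_lt_inv₀ ha0).2 ha1
  have hca : ∀ x, ContinuousAt (fun l => scaledSecond l x) (1 / 2) := fun x =>
    (continuousOn_scaledSecond x).continuousAt (Iio_mem_nhds (by norm_num))
  have hA : scaledSecond (1 / 2) (-a) < 0 := by
    rw [scaledSecond_half]
    exact mul_neg_of_pos_of_neg (Real.exp_pos _) (by nlinarith)
  have hB : 0 < scaledSecond (1 / 2) a⁻¹ + scaledSecond (1 / 2) (-a⁻¹) := by
    rw [scaledSecond_half, scaledSecond_half, neg_sq]
    have : 0 < Real.exp (-a⁻¹ ^ 2 / 2) * (a⁻¹ ^ 2 - 1) :=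
      mul_pos (Real.exp_pos _) (by nlinarith)
    linarith
  have hev := (((hca (-a)).eventually_lt_const hA).and
    (((hca a⁻¹).add (hca (-a⁻¹))).eventually_const_lt hB)).filter_mono
      (nhdsWithin_le_nhds (s := Iio (1 / 2)))
  obtain ⟨l, ⟨h1, h2⟩, hl⟩ :=
    (hev.and (Ioo_mem_nhdsLT (show (0 : ℝ) < 1 / 2 by norm_num))).exists
  have hp : 0 < 1 - 2 * l := by linarith [hl.2]
  rw [scaledSecond_eq hl.2] at h1
  rw [Pi.add_apply, scaledSecond_eq hl.2, scaledSecond_eq hl.2, ← mul_add] at h2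
  have h1' := ((signChange_x1 hl).2 a ha0).1.1 ((pos_iff_neg_of_mul_neg h1).1 hp)
  have h2' := ((signChange_z hl).2 _ hb0).2.1 (pos_of_mul_pos_right h2 hp.le)
  refine ⟨l, hl, (lt_div_iff₀ (signChange_z hl).1).2 (lt_trans ?_ h1')⟩
  calc σ * z l < σ * a⁻¹ := (mul_lt_mul_iff_right₀ hσ.1).2 h2'
    _ = a := by rw [← ha2]; field_simp

theorem existsUnique_isLambda {σ : ℝ} (hσ : σ ∈ Ioo (0 : ℝ) 1) : ∃! l, IsLambda σ l := by
  obtain ⟨a, ha, ha'⟩ := exists_sigmaOf_lt hσ.1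
  obtain ⟨b, hb, hb'⟩ := exists_lt_sigmaOf hσ
  obtain ⟨l, hl, hl'⟩ := isPreconnected_Ioo.intermediate_value ha hb continuousOn_sigmaOf
    ⟨ha'.le, hb'.le⟩
  exact ⟨l, ⟨hl, hl'⟩, fun m hm => sigmaOf_strictMonoOn.injOn hm.1 hl (hm.2.trans hl'.symm)⟩

theorem isLambda_lambdaOf {σ : ℝ} (hσ : σ ∈ Ioo (0 : ℝ) 1) : IsLambda σ (lambdaOf σ) :=
  Classical.epsilon_spec (existsUnique_isLambda hσ).exists

/-! ### Gluing and the G-heat equation -/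

theorem G_of_nonneg {σ a : ℝ} (ha : 0 ≤ a) : G σ a = a / 2 := by
  rw [G, max_eq_right ha, max_eq_left (neg_nonpos.2 ha)]
  ring

theorem G_of_nonpos {σ a : ℝ} (ha : a ≤ 0) : G σ a = σ ^ 2 * a / 2 := by
  rw [G, max_eq_left ha, max_eq_right (neg_nonneg.2 ha)]
  ring

theorem G_mul_of_nonneg {σ c : ℝ} (hc : 0 ≤ c) (a : ℝ) : G σ (c * a) = c * G σ a := by
  rcases le_total 0 a with h | h
  · rw [G_of_nonneg h, G_of_nonneg (mul_nonneg hc h)]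
    ring
  · rw [G_of_nonpos h, G_of_nonpos (mul_nonpos_of_nonneg_of_nonpos hc h)]
    ring

/-- A `C²` profile with `-l h - x h' / 2 = G(h'')` yields a self-similar classical solution. -/
theorem isClassicalSolution_selfSimilar {σ l : ℝ} {h h1 h2 : ℝ → ℝ}
    (hd1 : ∀ x, HasDerivAt h (h1 x) x) (hd2 : ∀ x, HasDerivAt h1 (h2 x) x) (hc : Continuous h2)
    (heq : ∀ x, -l * h x - x * h1 x / 2 = G σ (h2 x)) :
    IsClassicalSolution σ h fun t x => (1 + t) ^ (-l) * h (x / √(1 + t)) := by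
  have hch : Continuous h := continuous_iff_continuousAt.2 fun x => (hd1 x).continuousAt
  have hch1 : Continuous h1 := continuous_iff_continuousAt.2 fun x => (hd2 x).continuousAt
  have hpos : ∀ p ∈ Ici (0 : ℝ) ×ˢ (univ : Set ℝ), 0 < 1 + p.1 := fun p hp => by
    have : 0 ≤ p.1 := hp.1
    linarith
  have hξ : ContinuousOn (fun p : ℝ × ℝ => p.2 / √(1 + p.1)) (Ici 0 ×ˢ univ) :=
    ContinuousOn.div (by fun_prop) (by fun_prop) fun p hp => (Real.sqrt_pos.2 (hpos p hp)).ne'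
  have hpow : ∀ a : ℝ, ContinuousOn (fun p : ℝ × ℝ => (1 + p.1) ^ a) (Ici 0 ×ˢ univ) := fun a =>
    ContinuousOn.rpow_const (by fun_prop) fun p hp => Or.inl (hpos p hp).ne'
  have hcomp : ∀ f : ℝ → ℝ, Continuous f →
      ContinuousOn (fun p : ℝ × ℝ => f (p.2 / √(1 + p.1))) (Ici 0 ×ˢ univ) := fun f hf =>
    hf.comp_continuousOn hξ
  refine ⟨fun x => by simp, (hpow _).mul (hcomp h hch),
    fun t x => (1 + t) ^ (-l - 1) * (-l * h (x / √(1 + t)) -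
      x / √(1 + t) * h1 (x / √(1 + t)) / 2),
    fun t x => (1 + t) ^ (-l) * (h1 (x / √(1 + t)) / √(1 + t)),
    fun t x => (1 + t) ^ (-l - 1) * h2 (x / √(1 + t)),
    (hpow _).mul (((hcomp h hch).const_mul _).sub ((hξ.mul (hcomp h1 hch1)).div_const 2)),
    (hpow _).mul ((hcomp h1 hch1).div (by fun_prop)
      fun p hp => (Real.sqrt_pos.2 (hpos p hp)).ne'),
    (hpow _).mul (hcomp h2 hc), fun t ht x => ?_⟩
  have ht1 : 0 < 1 + t := by linarith
  have hs : 0 < √(1 + t) := Real.sqrt_pos.2 ht1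
  have hss : √(1 + t) * √(1 + t) = 1 + t := Real.mul_self_sqrt ht1.le
  have hr : (1 + t) ^ (-l) = (1 + t) ^ (-l - 1) * (√(1 + t) * √(1 + t)) := by
    rw [hss, ← Real.rpow_add_one ht1.ne']
    ring_nf
  have hx : HasDerivAt (fun y : ℝ => y / √(1 + t)) (1 / √(1 + t)) x :=
    (hasDerivAt_id x).div_const _
  refine ⟨HasDerivAt.hasDerivWithinAt ?_, ?_, ?_, ?_⟩
  · have ha : HasDerivAt (fun s : ℝ => 1 + s) 1 t := (hasDerivAt_id t).const_add 1
    have hq : HasDerivAt (fun s : ℝ => x / √(1 + s))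
        (-(x * (1 / (2 * √(1 + t)))) / √(1 + t) ^ 2) t :=
      ((hasDerivAt_const t x).div (ha.sqrt ht1.ne') hs.ne').congr_deriv (by simp)
    refine ((ha.rpow_const (p := -l) (Or.inl ht1.ne')).mul ((hd1 _).comp t hq)).congr_deriv ?_
    rw [hr]
    simp only [Function.comp_apply]
    field_simp
    ring
  · refine (((hd1 _).comp x hx).const_mul ((1 + t) ^ (-l))).congr_deriv ?_
    ring
  · refine ((((hd2 _).comp x hx).div_const √(1 + t)).const_mul ((1 + t) ^ (-l))).congr_deriv ?_
    rw [hr]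
    field_simp
  · rw [G_mul_of_nonneg (by positivity), ← heq]
    ring

/-- `f` on `(-∞, a]` and `g` on `(a, ∞)`. -/
def glue (a : ℝ) (f g : ℝ → ℝ) (x : ℝ) : ℝ := if x ≤ a then f x else g x

theorem glue_of_le {a x : ℝ} (f g : ℝ → ℝ) (h : x ≤ a) : glue a f g x = f x := if_pos h

theorem glue_of_lt {a x : ℝ} (f g : ℝ → ℝ) (h : a < x) : glue a f g x = g x := if_neg h.not_ge

theorem continuous_glue {a : ℝ} {f g : ℝ → ℝ} (hf : Continuous f) (hg : Continuous g)
    (h : f a = g a) : Continuous (glue a f g) :=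
  hf.if_le hg continuous_id continuous_const fun x hx => by rw [show x = a from hx, h]

theorem hasDerivAt_glue {a : ℝ} {f g f' g' : ℝ → ℝ} (hf : ∀ x, HasDerivAt f (f' x) x)
    (hg : ∀ x, HasDerivAt g (g' x) x) (h0 : f a = g a) (h1 : f' a = g' a) (x : ℝ) :
    HasDerivAt (glue a f g) (glue a f' g' x) x := by
  rcases lt_trichotomy x a with h | rfl | h
  · rw [glue_of_le _ _ h.le]
    refine (hf x).congr_of_eventuallyEq ?_
    filter_upwards [Iio_mem_nhds h] with y hy
    exact glue_of_le _ _ (mem_Iio.1 hy).le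
  · rw [glue_of_le _ _ le_rfl, ← hasDerivWithinAt_univ, ← Iic_union_Ici (a := x)]
    refine HasDerivWithinAt.union ((hf x).hasDerivWithinAt.congr
      (fun y hy => glue_of_le _ _ hy) (glue_of_le _ _ le_rfl)) ?_
    rw [h1]
    refine (hg x).hasDerivWithinAt.congr (fun y hy => ?_) ((glue_of_le _ _ le_rfl).trans h0)
    rcases (mem_Ici.1 hy).eq_or_lt with rfl | hy
    · exact (glue_of_le _ _ le_rfl).trans h0
    · exact glue_of_lt _ _ hy
  · rw [glue_of_lt _ _ h]
    refine (hg x).congr_of_eventuallyEq ?_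
    filter_upwards [Ioi_mem_nhds h] with y hy
    exact glue_of_lt _ _ hy

/-- The gluing of an outer solution `k` on `|x| ≥ s` with the inner function `e(x/σ)` on
`|x| < s`. If values agree at `s` and both second derivatives vanish there, then the two
differential equations force the first derivatives to agree, so that the result is `C²`. The outer
part is convex and the inner part concave, so that `G` selects the right equation on each part. -/
theorem exists_glued_profile {σ l s : ℝ} {e e1 k k1 : ℝ → ℝ} (hσ : 0 < σ) (hl : 0 < l)
    (hs : 0 < s) (he : IsPosSol (2 * l) e e1) (hk : IsPosSol (2 * l) k k1)
    (heven : ∀ x, e (-x) = e x) (hodd : ∀ x, e1 (-x) = -e1 x)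
    (he2 : -(s / σ * e1 (s / σ) + 2 * l * e (s / σ)) = 0)
    (hk2 : -(s * k1 s + 2 * l * k s) = 0) (hval : k s = e (s / σ)) :
    ∃ h1 h2 : ℝ → ℝ,
      let h := glue (-s) (fun x => k (-x)) (glue s (fun x => e (x / σ)) k)
      (∀ x, HasDerivAt h (h1 x) x) ∧ (∀ x, HasDerivAt h1 (h2 x) x) ∧ Continuous h2 ∧
      ∀ x, -l * h x - x * h1 x / 2 = G σ (h2 x) := by
  have hp : 0 < 2 * l := by linarith
  have hr := hk.reflect
  have hin1 : ∀ x, HasDerivAt (fun x => e (x / σ)) (e1 (x / σ) / σ) x := fun x =>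
    ((he.deriv1 _).comp x ((hasDerivAt_id' x).div_const σ)).congr_deriv (by ring)
  have hin2 : ∀ x, HasDerivAt (fun x => e1 (x / σ) / σ)
      (-(x / σ * e1 (x / σ) + 2 * l * e (x / σ)) / σ ^ 2) x := fun x =>
    (((he.deriv2 _).comp x ((hasDerivAt_id' x).div_const σ)).div_const σ).congr_deriv
      (by field_simp)
  have h1val : e1 (s / σ) / σ = k1 s := by
    have : s * (e1 (s / σ) / σ) = s * k1 s := by
      rw [hval] at hk2
      linear_combination hk2 - he2
    exact mul_left_cancel₀ hs.ne' this
  have hms : -s < s := by linarith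
  have hcrev : Continuous fun x => -(x * k1 x + 2 * l * k x) := by
    have := hk.continuous_fun
    have := hk.continuous_deriv
    fun_prop
  have hcrefl : Continuous fun x => -(x * -k1 (-x) + 2 * l * k (-x)) := by
    have := hk.continuous_fun
    have := hk.continuous_deriv
    fun_prop
  have hcin : Continuous fun x => -(x / σ * e1 (x / σ) + 2 * l * e (x / σ)) / σ ^ 2 := by
    have := he.continuous_fun
    have := he.continuous_deriv
    fun_prop
  have h2s : -(s / σ * e1 (s / σ) + 2 * l * e (s / σ)) / σ ^ 2 = -(s * k1 s + 2 * l * k s) := by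
    rw [he2, hk2, zero_div]
  have houter : ∀ x, s ≤ x → 0 ≤ -(x * k1 x + 2 * l * k x) := fun x hx => by
    rcases hx.eq_or_lt with rfl | hx
    · exact hk2.ge
    · exact (hk.second_pos_of_lt hp hs hx hk2.ge).le
  have hinner_pos : ∀ y, 0 ≤ y → y ≤ s / σ → -(y * e1 y + 2 * l * e y) ≤ 0 := fun y hy hys => by
    rcases hy.eq_or_lt with rfl | hy
    · have := mul_pos hp (he.pos 0)
      linarith
    · rcases hys.eq_or_lt with rfl | hys
      · exact he2.le
      · exact (he.second_neg_of_lt hp hy hys he2.le).le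
  have hinner : ∀ x, -s ≤ x → x ≤ s → -(x / σ * e1 (x / σ) + 2 * l * e (x / σ)) ≤ 0 :=
      fun x hx hx' => by
    rcases le_total 0 x with h | h
    · exact hinner_pos _ (by positivity) (by gcongr)
    · have := hinner_pos (-(x / σ)) (by rw [← neg_div]; exact div_nonneg (by linarith) hσ.le)
        (by rw [← neg_div]; gcongr; linarith)
      rw [heven, hodd] at this
      linarith
  refine ⟨glue (-s) (fun x => -k1 (-x)) (glue s (fun x => e1 (x / σ) / σ) k1),
    glue (-s) (fun x => -(x * -k1 (-x) + 2 * l * k (-x)))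
      (glue s (fun x => -(x / σ * e1 (x / σ) + 2 * l * e (x / σ)) / σ ^ 2)
        fun x => -(x * k1 x + 2 * l * k x)),
    hasDerivAt_glue hr.deriv1 (hasDerivAt_glue hin1 hk.deriv1 hval.symm h1val) ?_ ?_,
    hasDerivAt_glue hr.deriv2 (hasDerivAt_glue hin2 hk.deriv2 h1val h2s) ?_ ?_,
    continuous_glue hcrefl (continuous_glue hcin hcrev h2s) ?_, fun x => ?_⟩
  · rw [glue_of_le _ _ hms.le, neg_neg, neg_div, heven, hval]
  · rw [glue_of_le _ _ hms.le, neg_neg, neg_div, hodd, neg_div, h1val]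
  · rw [glue_of_le _ _ hms.le, neg_neg, neg_div, hodd, neg_div, h1val]
  · rw [glue_of_le _ _ hms.le, neg_neg, neg_div σ s, heven, hodd, neg_mul_neg, neg_mul_neg, h2s]
  · rw [glue_of_le _ _ hms.le, neg_neg, neg_div σ s, heven, hodd, neg_mul_neg, neg_mul_neg, h2s]
  · rcases le_or_gt x (-s) with hx | hx
    · simp only [glue_of_le _ _ hx]
      have := houter (-x) (by linarith)
      rw [G_of_nonneg (by linarith)]
      ring
    · simp only [glue_of_lt _ _ hx]
      rcases le_or_gt x s with hx' | hx'
      · simp only [glue_of_le _ _ hx']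
        rw [G_of_nonpos (div_nonpos_of_nonpos_of_nonneg (hinner x hx.le hx') (by positivity))]
        field_simp
        ring
      · simp only [glue_of_lt _ _ hx']
        rw [G_of_nonneg (houter x hx'.le)]
        ring

section Coefficients

variable {l σ : ℝ}

theorem phi''_signs (hσ : σ ∈ Ioo (0 : ℝ) 1) (hl : l ∈ Ioc 0 (lambdaOf σ)) :
    l ∈ Ioo (0 : ℝ) (1 / 2) ∧ 0 < σ * z l ∧ 0 ≤ phi'' l (-(σ * z l)) ∧ phi'' l (σ * z l) < 0 := by
  have hL := isLambda_lambdaOf hσ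
  have hlI : l ∈ Ioo (0 : ℝ) (1 / 2) := ⟨hl.1, hl.2.trans_lt hL.1.2⟩
  have hz := signChange_z hlI
  have hs : 0 < σ * z l := mul_pos hσ.1 hz.1
  have hle : sigmaOf l ≤ σ := (sigmaOf_strictMonoOn.monotoneOn hlI hL.1 hl.2).trans_eq hL.2
  have h1 : -x1 l ≤ σ * z l := (div_le_iff₀ hz.1).1 hle
  have h2 : 0 ≤ phi'' l (-(σ * z l)) := by
    by_contra! hc
    exact (((signChange_x1 hlI).2 _ hs).1.1 hc).not_ge h1
  have h3 := (hz.2 _ hs).1.2 (mul_lt_of_lt_one_left hz.1 hσ.2)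
  exact ⟨hlI, hs, h2, by linarith⟩

theorem det_neg (hl : l < 1 / 2) {s : ℝ} (h1 : 0 ≤ phi'' l (-s)) (h2 : phi'' l s < 0) :
    phi l (-s) * phi'' l s - phi l s * phi'' l (-s) < 0 := by
  have hφ := (isPosSol_phi hl).pos
  have h3 := mul_neg_of_pos_of_neg (hφ (-s)) h2
  have h4 := mul_nonneg (hφ s).le h1
  linarith

theorem mu1_pos (hσ : σ ∈ Ioo (0 : ℝ) 1) (hl : l ∈ Ioc 0 (lambdaOf σ)) : 0 < mu1 l σ := by
  obtain ⟨hlI, hs, h1, h2⟩ := phi''_signs hσ hl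
  have hφ := (isPosSol_phi hlI.2).pos
  exact mul_pos (mul_pos_of_neg_of_neg h2 (inv_neg''.2 (det_neg hlI.2 h1 h2)))
    (add_pos (hφ _) (hφ _))

theorem mu2_nonneg (hσ : σ ∈ Ioo (0 : ℝ) 1) (hl : l ∈ Ioc 0 (lambdaOf σ)) : 0 ≤ mu2 l σ := by
  obtain ⟨hlI, hs, h1, h2⟩ := phi''_signs hσ hl
  have hφ := (isPosSol_phi hlI.2).pos
  have hD := det_neg hlI.2 h1 h2
  exact mul_nonneg (mul_nonneg h1 (inv_nonneg.2 (by linarith))) (add_pos (hφ _) (hφ _)).le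

/-- The coefficients solve the linear system `k(s) = φ_l(z) + φ_l(-z)`, `k''(s) = 0` for
`k(x) = μ₂ φ_l(x) + μ₁ φ_l(-x)`. -/
theorem mu_system (hσ : σ ∈ Ioo (0 : ℝ) 1) (hl : l ∈ Ioc 0 (lambdaOf σ)) :
    mu2 l σ * phi l (σ * z l) + mu1 l σ * phi l (-(σ * z l)) = evenSol l (z l) ∧
      mu2 l σ * phi'' l (σ * z l) + mu1 l σ * phi'' l (-(σ * z l)) = 0 := by
  obtain ⟨hlI, hs, h1, h2⟩ := phi''_signs hσ hl
  have hD := (det_neg hlI.2 h1 h2).ne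
  have hD' : phi l (σ * z l) * phi'' l (-(σ * z l)) - phi l (-(σ * z l)) * phi'' l (σ * z l) =
      -(phi l (-(σ * z l)) * phi'' l (σ * z l) - phi l (σ * z l) * phi'' l (-(σ * z l))) := by
    ring
  rw [mu1, mu2, hD', inv_neg, evenSol]
  constructor
  · linear_combination (phi l (-z l) + phi l (z l)) * mul_inv_cancel₀ hD
  · ring

theorem H_eq_glue (hval : phi l (z l) + phi l (-z l) =
      mu2 l σ * phi l (σ * z l) + mu1 l σ * phi l (-(σ * z l))) (hσ : σ ≠ 0) :
    H l σ = glue (-(σ * z l)) (fun x => mu2 l σ * phi l (-x) + mu1 l σ * phi l (- -x))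
      (glue (σ * z l) (fun x => evenSol l (x / σ))
        fun x => mu2 l σ * phi l x + mu1 l σ * phi l (-x)) := by
  ext x
  unfold H glue
  split_ifs with h1 h2 h3 h3
  · simp only [neg_neg, add_comm]
  · simp only [evenSol, neg_div]
  · exact absurd h2.le h3
  · simp only [le_antisymm h3 (not_lt.1 h2), evenSol]
    rw [mul_div_cancel_left₀ _ hσ, hval]
  · rfl

theorem H_pos (hσ : σ ∈ Ioo (0 : ℝ) 1) (hl : l ∈ Ioc 0 (lambdaOf σ)) (x : ℝ) : 0 < H l σ x := by
  have hφ := (isPosSol_phi (phi''_signs hσ hl).1.2).pos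
  have h1 := mu1_pos hσ hl
  have h2 := mu2_nonneg hσ hl
  unfold H
  split_ifs
  · exact add_pos_of_pos_of_nonneg (mul_pos h1 (hφ _)) (mul_nonneg h2 (hφ _).le)
  · exact add_pos (hφ _) (hφ _)
  · exact add_pos_of_nonneg_of_pos (mul_nonneg h2 (hφ _).le) (mul_pos h1 (hφ _))

theorem isClassicalSolution_u (hσ : σ ∈ Ioo (0 : ℝ) 1) (hl : l ∈ Ioc 0 (lambdaOf σ)) :
    IsClassicalSolution σ (H l σ) (u l σ) := by
  obtain ⟨hlI, hs, -, -⟩ := phi''_signs hσ hl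
  obtain ⟨hv, hw⟩ := mu_system hσ hl
  have hdiv : σ * z l / σ = z l := mul_div_cancel_left₀ _ hσ.1.ne'
  have t := isPosSol_phi hlI.2
  obtain ⟨h1, h2, hd1, hd2, hc, heq⟩ := exists_glued_profile hσ.1 hl.1 hs
    (isPosSol_evenSol hlI.2) (t.combo t.reflect (mu2_nonneg hσ hl) (mu1_pos hσ hl))
    (fun x => by rw [evenSol, evenSol, neg_neg, add_comm])
    (fun x => by rw [evenSol1, evenSol1, neg_neg, neg_sub])
    (by rw [hdiv, second_evenSol hlI.2]; exact (signChange_z hlI).eq_zero)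
    (by
      rw [phi''_eq hlI.2, phi''_eq hlI.2] at hw
      linear_combination hw)
    (by rw [hdiv]; exact hv)
  rw [← H_eq_glue hv.symm hσ.1.ne'] at hd1 heq
  exact isClassicalSolution_selfSimilar hd1 hd2 hc heq

end Coefficients

end GHeat

end

theorem theorem2113 (σ : ℝ) (hσ : σ ∈ Set.Ioo (0 : ℝ) 1) :
    -- the constants entering the construction are well defined
    (∀ l ∈ Set.Ioo (0 : ℝ) (1 / 2), (∃! x, GHeat.IsX1 l x) ∧ (∃! z, GHeat.IsZ l z)) ∧
    (∃! l, GHeat.IsLambda σ l) ∧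
    -- the explicit positive solutions
    (∀ l ∈ Set.Ioc (0 : ℝ) (GHeat.lambdaOf σ),
      0 < GHeat.mu1 l σ ∧ 0 ≤ GHeat.mu2 l σ ∧
      GHeat.IsClassicalSolution σ (GHeat.H l σ) (GHeat.u l σ) ∧
      (∀ t, 0 ≤ t → ∀ x, 0 < GHeat.u l σ t x)) := by
  refine ⟨fun l hl => ⟨GHeat.existsUnique_isX1 hl, GHeat.existsUnique_isZ hl⟩,
    GHeat.existsUnique_isLambda hσ, fun l hl => ⟨GHeat.mu1_pos hσ hl, GHeat.mu2_nonneg hσ hl,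
      GHeat.isClassicalSolution_u hσ hl, fun t ht x => ?_⟩⟩
  exact mul_pos (Real.rpow_pos_of_pos (by linarith) _) (GHeat.H_pos hσ hl _)
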